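/- Let $\Sigma$ be the set of distributions, i.e. of unital linear functionals $\mu:\mathbb{C}[z]\to\mathbb{C}$, with moments $m_n(\mu)=\mu(z^n)$, and let $\Sigma_1^{\times}=\{\mu\in\Sigma : m_1(\mu)=1\}$. For $\mu,\nu\in\Sigma$ let $\mu\boxplus_V\nu$ and $\mu\boxtimes_V\nu$ be the distributions of $a+b$ and of $ab$, where $a,b$ are free random variables with distributions $\mu,\nu$ in a non-commutative probability space over $\mathbb{C}$. Let $\Lambda(\mathbb{C})=1+z\,\mathbb{C}[[z]]$ with the multiplication of power series. For $\mu\in\Sigma_1^{\times}$ the $S$-transform is $S_V(\mu)(z)=\frac{1+z}{z}\chi_\mu(z)\in\Lambda(\mathbb{C})$, where $\chi_\mu$ is the compositional inverse of $\psi_\mu(z)=\sum_{n\ge1}m_n(\mu)z^n$. For $\mu\in\Sigma$ the $R$-transform $R_V(\mu)\in\mathbb{C}[[z]]$ is the power series determined by $G_\mu\big(R_V(\mu)(z)+\tfrac1z\big)=z$, where $G_\mu(w)=\sum_{n\ge0}m_n(\mu)w^{-n-1}$. Then $(\Sigma_1^{\times},\boxtimes_V)$ and $(\Sigma,\boxplus_V)$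 are (abelian) groups; the maps $$S_V:(\Sigma_1^{\times},\boxtimes_V)\to(\Lambda(\mathbb{C}),\cdot),\qquad \tfrac{d}{dz}\log:(\Lambda(\mathbb{C}),\cdot)\to(\mathbb{C}[[z]],+),\qquad R_V:(\Sigma,\boxplus_V)\to(\mathbb{C}[[z]],+)$$ are group isomorphisms; and consequently $$\operatorname{LOG}:=R_V^{-1}\circ\tfrac{d}{dz}\log\circ S_V:(\Sigma_1^{\times},\boxtimes_V)\to(\Sigma,\boxplus_V)$$ is a group isomorphism, with an inverse $\operatorname{EXP}:(\Sigma,\boxplus_V)\to(\Sigma_1^{\times},\boxtimes_V)$. -/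

import Mathlib

open scoped Polynomial PowerSeries

namespace FreeProb

noncomputable section

/-! ## Distributions -/

/-- The set `Σ` of (one-dimensional, algebraic) distributions: unital linear functionals
`ℂ[z] → ℂ`. -/
def Distribution : Type := {μ : ℂ[X] →ₗ[ℂ] ℂ // μ 1 = 1}

/-- The `n`-th moment `μ(zⁿ)` of a distribution. -/
def Distribution.moment (μ : Distribution) (n : ℕ) : ℂ := μ.1 (Polynomial.X ^ n)

/-- The set `Σ^×_1` of distributions with mean `1`. -/
def MeanOne : Type := {μ : Distribution // μ.moment 1 = 1}

/-- The distribution of a random variable `a` in the non-commutative probability space `(A, φ)`: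
the functional `p ↦ φ(p(a))`. -/
def distribution {A : Type*} [Ring A] [Algebra ℂ A] (φ : A →ₗ[ℂ] ℂ) (hφ : φ 1 = 1) (a : A) :
    Distribution :=
  ⟨φ ∘ₗ (Polynomial.aeval a).toLinearMap, by simp [hφ]⟩

/-! ## Freeness -/

/-- Freeness of a family of unital subalgebras of `(A, φ)`: `φ(x₁ ⋯ x_m) = 0` for `m ≥ 1` whenever
the `x_k` are centred and neighbouring factors are taken from different subalgebras. -/
def IsFree {A ι : Type*} [Ring A] [Algebra ℂ A] (φ : A →ₗ[ℂ] ℂ) (B : ι → Subalgebra ℂ A) : Prop :=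
  ∀ l : List (ι × A), l ≠ [] → l.IsChain (fun p q => p.1 ≠ q.1) →
    (∀ p ∈ l, p.2 ∈ B p.1 ∧ φ p.2 = 0) → φ (l.map Prod.snd).prod = 0

/-- Freeness of two random variables: the unital subalgebras they generate are free. -/
def FreePair {A : Type*} [Ring A] [Algebra ℂ A] (φ : A →ₗ[ℂ] ℂ) (a b : A) : Prop :=
  IsFree φ (fun i : Fin 2 => Algebra.adjoin ℂ {![a, b] i})

/-! ## The free product of distributions

The reduced free product of the spaces `(ℂ[z], μ i)`. The basis vector indexed by the list
`(i₁, n₁), …, (i_k, n_k)` stands for the product of the centred monomials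
`a_{i₁}^{n₁} - m_{n₁}(μ i₁), …, a_{i_k}^{n_k} - m_{n_k}(μ i_k)`, and `a_i` acts by left
multiplication. -/

/-- The vector space on which the free product is represented. -/
abbrev FockSpace (ι : Type*) : Type _ := List (ι × ℕ) →₀ ℂ

/-- The vacuum state `T ↦ ⟨T Ω, Ω⟩`, where `Ω` is the basis vector of the empty list. -/
def vacuum (ι : Type*) : Module.End ℂ (FockSpace ι) →ₗ[ℂ] ℂ where
  toFun T := T (Finsupp.single [] 1) []
  map_add' _ _ := rfl
  map_smul' _ _ := rfl

theorem vacuum_apply {ι : Type*} (T : Module.End ℂ (FockSpace ι)) :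
    vacuum ι T = T (Finsupp.single [] 1) [] := rfl

theorem vacuum_one {ι : Type*} : vacuum ι 1 = 1 := by simp [vacuum_apply]

section Model

variable {ι : Type*} [DecidableEq ι]

/-- Left multiplication by `a_i` on a basis vector. -/
def act (μ : ι → Distribution) (i : ι) : List (ι × ℕ) → FockSpace ι
  | [] => Finsupp.single [(i, 1)] 1 + (μ i).moment 1 • Finsupp.single [] 1
  | (j, n) :: w =>
    if j = i then
      Finsupp.single ((i, n + 1) :: w) 1
        + ((μ i).moment (n + 1) - (μ i).moment n * (μ i).moment 1) • Finsupp.single w 1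
        - (μ i).moment n • Finsupp.single ((i, 1) :: w) 1
    else
      Finsupp.single ((i, 1) :: (j, n) :: w) 1 + (μ i).moment 1 • Finsupp.single ((j, n) :: w) 1

/-- The random variable `a_i` of the free product: left multiplication by `a_i`. -/
def freeVar (μ : ι → Distribution) (i : ι) : Module.End ℂ (FockSpace ι) :=
  Finsupp.linearCombination ℂ (act μ i)

end Model

/-! ## Free convolutions -/

/-- Free additive convolution `μ ⊞_V ν`: the distribution of `a + b` for free random variables
`a`, `b` with distributions `μ`, `ν`. -/
def freeAdd (μ ν : Distribution) : Distribution :=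
  distribution (vacuum (Fin 2)) vacuum_one (freeVar ![μ, ν] 0 + freeVar ![μ, ν] 1)

/-- Free multiplicative convolution `μ ⊠_V ν`: the distribution of `a * b` for free random variables
`a`, `b` with distributions `μ`, `ν`. -/
def freeMul (μ ν : Distribution) : Distribution :=
  distribution (vacuum (Fin 2)) vacuum_one (freeVar ![μ, ν] 0 * freeVar ![μ, ν] 1)

section Facts

variable {ι : Type*} [DecidableEq ι]

theorem moment_zero (μ : Distribution) : μ.moment 0 = 1 := by
  simpa [Distribution.moment] using μ.2

theorem distribution_ext {μ ν : Distribution} (h : ∀ n, μ.moment n = ν.moment n) : μ = ν := by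
  apply Subtype.ext
  apply Polynomial.lhom_ext'
  intro n
  ext
  have := h n
  simpa [Distribution.moment, ← Polynomial.X_pow_eq_monomial] using this

theorem moment_distribution {A : Type*} [Ring A] [Algebra ℂ A] (φ : A →ₗ[ℂ] ℂ) (hφ : φ 1 = 1)
    (a : A) (n : ℕ) : (distribution φ hφ a).moment n = φ (a ^ n) := by
  simp [Distribution.moment, distribution]

theorem act_of_ne (μ : ι → Distribution) (i : ι) (w : List (ι × ℕ))
    (hw : ∀ p ∈ w.head?, p.1 ≠ i) :
    act μ i w = Finsupp.single ((i, 1) :: w) 1 + (μ i).moment 1 • Finsupp.single w 1 := by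
  match w with
  | [] => rfl
  | (j, n) :: w =>
    have : j ≠ i := hw (j, n) (by simp)
    simp [act, this]

/-- The action of a power of `a_i` on a basis vector whose first letter is not an `a_i`. -/
theorem freeVar_pow_single (μ : ι → Distribution) (i : ι) (w : List (ι × ℕ))
    (hw : ∀ p ∈ w.head?, p.1 ≠ i) (n : ℕ) :
    (freeVar μ i ^ (n + 1)) (Finsupp.single w 1) =
      Finsupp.single ((i, n + 1) :: w) 1 + (μ i).moment (n + 1) • Finsupp.single w 1 := by
  induction n with
  | zero => simp [freeVar, act_of_ne μ i w hw]
  | succ n ih =>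
    rw [pow_succ', Module.End.mul_apply, ih, map_add, map_smul]
    simp only [freeVar, Finsupp.linearCombination_single, one_smul, act_of_ne μ i w hw]
    simp only [act, if_true]
    module

/-- The action of a centred polynomial in `a_i` on such a basis vector. -/
theorem aeval_freeVar_single (μ : ι → Distribution) (i : ι) (w : List (ι × ℕ))
    (hw : ∀ p ∈ w.head?, p.1 ≠ i) (p : ℂ[X]) :
    (Polynomial.aeval (freeVar μ i) p) (Finsupp.single w 1) =
      (∑ n ∈ Finset.range p.natDegree, p.coeff (n + 1) • Finsupp.single ((i, n + 1) :: w) 1)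
        + (μ i).1 p • Finsupp.single w 1 := by
  have h1 : (μ i).1 p = p.coeff 0 + ∑ n ∈ Finset.range p.natDegree,
      p.coeff (n + 1) * (μ i).moment (n + 1) := by
    conv_lhs => rw [p.as_sum_range' (p.natDegree + 1) (Nat.lt_succ_self _)]
    rw [map_sum, Finset.sum_range_succ', add_comm]
    have h0 := (μ i).2
    congr 1
    · rw [← mul_one (p.coeff 0), ← smul_eq_mul, ← Polynomial.smul_monomial, map_smul]
      simp [h0]
    · refine Finset.sum_congr rfl fun n _ => ?_
      rw [← mul_one (p.coeff (n + 1)), ← smul_eq_mul, ← Polynomial.smul_monomial, map_smul,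
        Distribution.moment, Polynomial.X_pow_eq_monomial]
      simp
  rw [Polynomial.aeval_eq_sum_range, Finset.sum_range_succ']
  simp only [LinearMap.add_apply, LinearMap.sum_apply, LinearMap.smul_apply, pow_zero,
    Module.End.one_apply, freeVar_pow_single μ i w hw, smul_add, Finset.sum_add_distrib, h1,
    add_smul, Finset.sum_smul, mul_smul]
  abel

theorem distribution_freeVar (μ : ι → Distribution) (i : ι) :
    distribution (vacuum ι) vacuum_one (freeVar μ i) = μ i := by
  apply distribution_ext
  intro n
  rw [moment_distribution]
  cases n with
  | zero => simp [vacuum_one, moment_zero]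
  | succ n =>
    have := freeVar_pow_single μ i [] (by simp) n
    simp [vacuum_apply, this]

/-- The random variables of the free product are free. -/
theorem isFree_freeVar (μ : ι → Distribution) :
    IsFree (vacuum ι) (fun i => Algebra.adjoin ℂ {freeVar μ i}) := by
  have key : ∀ l : List (ι × Module.End ℂ (FockSpace ι)),
      l.IsChain (fun p q => p.1 ≠ q.1) →
      (∀ p ∈ l, p.2 ∈ Algebra.adjoin ℂ {freeVar μ p.1} ∧ vacuum ι p.2 = 0) →
      (l.map Prod.snd).prod (Finsupp.single [] 1) ∈ Submodule.span ℂ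
        ((fun w => Finsupp.single w (1 : ℂ)) '' {w : List (ι × ℕ) |
          w.head?.map Prod.fst = l.head?.map Prod.fst}) := by
    intro l
    induction l with
    | nil =>
      intro _ _
      exact Submodule.subset_span ⟨[], by simp, by simp⟩
    | cons q l ih =>
      intro hc hm
      obtain ⟨i, T⟩ := q
      have ih' := ih hc.tail (fun p hp => hm p (List.mem_cons_of_mem _ hp))
      obtain ⟨hT, hT0⟩ := hm (i, T) (by simp)
      simp only at hT hT0
      rw [Algebra.adjoin_singleton_eq_range_aeval] at hT
      obtain ⟨p, rfl⟩ := hT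
      have hp0 : (μ i).1 p = 0 := by
        rw [← distribution_freeVar μ i]
        exact hT0
      simp only [List.map_cons, List.prod_cons, Module.End.mul_apply]
      have hmap := Submodule.mem_map_of_mem (f := Polynomial.aeval (freeVar μ i) p) ih'
      rw [Submodule.map_span] at hmap
      refine Submodule.span_le.2 ?_ hmap
      rintro _ ⟨_, ⟨w, hw, rfl⟩, rfl⟩
      have hw' : ∀ r ∈ w.head?, r.1 ≠ i := by
        intro r hr
        simp only [Set.mem_ofPred_eq] at hw
        cases l with
        | nil => cases w <;> simp_all
        | cons s l =>
          have hs : i ≠ s.1 := by simpa using hc.rel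
          cases w with
          | nil => simp at hr
          | cons t w =>
            simp only [List.head?_cons, Option.mem_def, Option.some.injEq] at hr
            subst hr
            simp only [List.head?_cons, Option.map_some, Option.some.injEq] at hw
            rw [hw]
            exact hs.symm
      simp only [SetLike.mem_coe]
      rw [aeval_freeVar_single μ i w hw', hp0, zero_smul, add_zero]
      refine Submodule.sum_mem _ fun n _ => Submodule.smul_mem _ _ (Submodule.subset_span ?_)
      exact ⟨(i, n + 1) :: w, by simp, rfl⟩
  intro l hl hc hm
  have hk := key l hc hm
  have hle : Submodule.span ℂ ((fun w => Finsupp.single w (1 : ℂ)) '' {w : List (ι × ℕ) |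
      w.head?.map Prod.fst = l.head?.map Prod.fst}) ≤
      LinearMap.ker (Finsupp.lapply (R := ℂ) (M := ℂ) ([] : List (ι × ℕ))) := by
    rw [Submodule.span_le]
    rintro _ ⟨w, hw, rfl⟩
    cases l with
    | nil => exact absurd rfl hl
    | cons q l => cases w <;> simp_all
  exact hle hk

/-- The basis vector of a list, evaluated in random variables `a i` of a space `(A, φ)`. -/
def evalWord {A : Type*} [Ring A] [Algebra ℂ A] (μ : ι → Distribution) (a : ι → A) :
    List (ι × ℕ) → A
  | [] => 1
  | (i, n) :: w => (a i ^ n - algebraMap ℂ A ((μ i).moment n)) * evalWord μ a w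

/-- Admissible lists: positive exponents, neighbouring letters different. -/
def Admissible (w : List (ι × ℕ)) : Prop :=
  w.IsChain (fun p q => p.1 ≠ q.1) ∧ ∀ p ∈ w, p.2 ≠ 0

theorem evalWord_freeVar {A : Type*} [Ring A] [Algebra ℂ A] (μ : ι → Distribution) (a : ι → A)
    (i : ι) (x : FockSpace ι) :
    Finsupp.linearCombination ℂ (evalWord μ a) (freeVar μ i x) =
      a i * Finsupp.linearCombination ℂ (evalWord μ a) x := by
  induction x using Finsupp.induction_linear with
  | zero => simp
  | add x y hx hy => simp [mul_add, hx, hy]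
  | single w c =>
    simp only [freeVar, Finsupp.linearCombination_single, map_smul, mul_smul_comm]
    congr 1
    match w with
    | [] => simp [act, evalWord, Algebra.smul_def]
    | (j, n) :: w =>
      by_cases h : j = i
      · subst h
        simp only [act, if_true, map_add, map_sub, map_smul, Finsupp.linearCombination_single,
          evalWord, pow_succ', pow_zero, mul_one, one_smul]
        simp only [Algebra.smul_def, map_sub, map_mul]
        have e : algebraMap ℂ A ((μ j).moment n) * a j = a j * algebraMap ℂ A ((μ j).moment n) :=
          Algebra.commutes _ _
        simp only [sub_mul, mul_sub, ← mul_assoc, e]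
        abel
      · simp only [act, h, if_false, map_add, map_smul, Finsupp.linearCombination_single,
          one_smul, evalWord, pow_one]
        simp only [Algebra.smul_def]
        noncomm_ring

theorem freeVar_mem_admissible (μ : ι → Distribution) (i : ι) {x : FockSpace ι}
    (hx : x ∈ Submodule.span ℂ ((fun w => Finsupp.single w (1 : ℂ)) '' {w | Admissible w})) :
    freeVar μ i x ∈
      Submodule.span ℂ ((fun w => Finsupp.single w (1 : ℂ)) '' {w : List (ι × ℕ) | Admissible w}) := by
  have hmap := Submodule.mem_map_of_mem (f := freeVar μ i) hx
  rw [Submodule.map_span] at hmap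
  refine Submodule.span_le.2 ?_ hmap
  rintro _ ⟨_, ⟨w, hw, rfl⟩, rfl⟩
  have sub : ∀ v : List (ι × ℕ), Admissible v → Finsupp.single v (1 : ℂ) ∈
      Submodule.span ℂ ((fun w => Finsupp.single w (1 : ℂ)) '' {w : List (ι × ℕ) | Admissible w}) :=
    fun v hv => Submodule.subset_span ⟨v, hv, rfl⟩
  simp only [freeVar, Finsupp.linearCombination_single, one_smul, SetLike.mem_coe]
  obtain ⟨hc, hp⟩ := hw
  match w with
  | [] =>
    exact Submodule.add_mem _ (sub _ ⟨by simp, by simp⟩)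
      (Submodule.smul_mem _ _ (sub _ ⟨by simp, by simp⟩))
  | (j, n) :: w =>
    by_cases h : j = i
    · subst h
      simp only [act, if_true]
      have ht : Admissible w := ⟨hc.tail, fun p hp' => hp p (List.mem_cons_of_mem _ hp')⟩
      have hcons : ∀ m, m ≠ 0 → Admissible ((j, m) :: w) := fun m hm => by
        refine ⟨?_, by simpa [hm] using ht.2⟩
        rw [List.isChain_cons] at hc ⊢
        exact hc
      exact Submodule.sub_mem _ (Submodule.add_mem _ (sub _ (hcons _ (by simp)))
        (Submodule.smul_mem _ _ (sub _ ht))) (Submodule.smul_mem _ _ (sub _ (hcons _ (by simp))))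
    · simp only [act, h, if_false]
      refine Submodule.add_mem _ (sub _ ⟨?_, ?_⟩) (Submodule.smul_mem _ _ (sub _ ⟨hc, hp⟩))
      · rw [List.isChain_cons_cons]
        exact ⟨fun h' => h h'.symm, hc⟩
      · intro p hp'
        rcases List.mem_cons.1 hp' with rfl | hp'
        · simp
        · exact hp p hp'

/-- The joint distribution of a free family is that of the random variables of the free product. -/
theorem apply_prod_of_isFree {A : Type*} [Ring A] [Algebra ℂ A] (φ : A →ₗ[ℂ] ℂ) (hφ : φ 1 = 1)
    (a : ι → A) (h : IsFree φ (fun i => Algebra.adjoin ℂ {a i})) (l : List ι) :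
    φ (l.map a).prod =
      vacuum ι (l.map (freeVar fun i => distribution φ hφ (a i))).prod := by
  set μ : ι → Distribution := fun i => distribution φ hφ (a i) with hμ
  have h1 : ∀ l : List ι, Finsupp.linearCombination ℂ (evalWord μ a)
      ((l.map (freeVar μ)).prod (Finsupp.single [] 1)) = (l.map a).prod := by
    intro l
    induction l with
    | nil => simp [evalWord]
    | cons i l ih =>
      simp only [List.map_cons, List.prod_cons, Module.End.mul_apply]
      rw [evalWord_freeVar, ih]
  have h2 : ∀ l : List ι, (l.map (freeVar μ)).prod (Finsupp.single [] 1) ∈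
      Submodule.span ℂ ((fun w => Finsupp.single w (1 : ℂ)) '' {w | Admissible w}) := by
    intro l
    induction l with
    | nil => exact Submodule.subset_span ⟨[], ⟨by simp, by simp⟩, by simp⟩
    | cons i l ih =>
      simp only [List.map_cons, List.prod_cons, Module.End.mul_apply]
      exact freeVar_mem_admissible μ i ih
  have h3 : ∀ w : List (ι × ℕ), Admissible w → w ≠ [] → φ (evalWord μ a w) = 0 := by
    intro w hw hne
    have := h (w.map fun p => (p.1, a p.1 ^ p.2 - algebraMap ℂ A ((μ p.1).moment p.2)))
      (by simpa using hne) (by rw [List.isChain_map]; exact hw.1) (by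
        intro q hq
        obtain ⟨p, -, rfl⟩ := List.mem_map.1 hq
        refine ⟨Subalgebra.sub_mem _ (Subalgebra.pow_mem _
          (Algebra.subset_adjoin (Set.mem_singleton _)) _) (Subalgebra.algebraMap_mem _ _), ?_⟩
        simp [Algebra.algebraMap_eq_smul_one, hφ, hμ, moment_distribution])
    rw [← this]
    congr 1
    clear this hw hne
    induction w with
    | nil => rfl
    | cons p w ih => simp [evalWord, ih]
  have h4 : ∀ x ∈ Submodule.span ℂ ((fun w => Finsupp.single w (1 : ℂ)) ''
      {w : List (ι × ℕ) | Admissible w}),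
      φ (Finsupp.linearCombination ℂ (evalWord μ a) x) = x [] := by
    intro x hx
    induction hx using Submodule.span_induction with
    | mem x hx =>
      obtain ⟨w, hw, rfl⟩ := hx
      by_cases hne : w = []
      · subst hne
        simp [evalWord, hφ]
      · simp [h3 w hw hne, hne]
    | zero => simp
    | add x y _ _ hx hy => simp [hx, hy]
    | smul c x _ hx => simp [hx]
  rw [← h1 l, h4 _ (h2 l)]
  rfl

/-- A polynomial expression in a free pair has the same expectation as in the free product. -/
theorem apply_freeAlgebra_of_freePair {A : Type*} [Ring A] [Algebra ℂ A] (φ : A →ₗ[ℂ] ℂ)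
    (hφ : φ 1 = 1) (a b : A) (h : FreePair φ a b) (x : FreeAlgebra ℂ (Fin 2)) :
    φ (FreeAlgebra.lift ℂ ![a, b] x) = vacuum (Fin 2) (FreeAlgebra.lift ℂ
      (freeVar ![distribution φ hφ a, distribution φ hφ b]) x) := by
  have e : ![distribution φ hφ a, distribution φ hφ b] =
      fun i : Fin 2 => distribution φ hφ (![a, b] i) := by
    funext i
    fin_cases i <;> rfl
  rw [e]
  have hx : x ∈ Submodule.span ℂ (Submonoid.closure (Set.range (FreeAlgebra.ι ℂ (X := Fin 2))) :
      Set (FreeAlgebra ℂ (Fin 2))) := by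
    rw [← Algebra.adjoin_eq_span, FreeAlgebra.adjoin_range_ι]
    trivial
  induction hx using Submodule.span_induction with
  | zero => simp
  | add x y _ _ hx hy => simp [hx, hy]
  | smul c x _ hx => simp [hx]
  | mem x hx =>
    obtain ⟨l, hl, rfl⟩ := Submonoid.exists_list_of_mem_closure hx
    have : ∃ l' : List (Fin 2), l = l'.map (FreeAlgebra.ι ℂ) := by
      clear hx
      induction l with
      | nil => exact ⟨[], rfl⟩
      | cons y l ih =>
        obtain ⟨l', rfl⟩ := ih fun y hy => hl y (List.mem_cons_of_mem _ hy)
        obtain ⟨i, rfl⟩ := hl y (by simp)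
        exact ⟨i :: l', rfl⟩
    obtain ⟨l', rfl⟩ := this
    have := apply_prod_of_isFree φ hφ ![a, b] h l'
    simpa [map_list_prod, Function.comp_def] using this

/-- The random variables that define `freeAdd` and `freeMul` are free. -/
theorem freePair_freeVar (μ ν : Distribution) :
    FreePair (vacuum (Fin 2)) (freeVar ![μ, ν] 0) (freeVar ![μ, ν] 1) := by
  have := isFree_freeVar ![μ, ν]
  unfold FreePair
  convert this using 3 with i
  fin_cases i <;> rfl

/-- `freeAdd` is the distribution of a sum of any two free random variables. -/
theorem distribution_add_of_freePair {A : Type*} [Ring A] [Algebra ℂ A] (φ : A →ₗ[ℂ] ℂ)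
    (hφ : φ 1 = 1) (a b : A) (h : FreePair φ a b) :
    distribution φ hφ (a + b) = freeAdd (distribution φ hφ a) (distribution φ hφ b) := by
  apply distribution_ext
  intro n
  have := apply_freeAlgebra_of_freePair φ hφ a b h
    ((FreeAlgebra.ι ℂ 0 + FreeAlgebra.ι ℂ 1) ^ n)
  rw [freeAdd, moment_distribution, moment_distribution]
  simpa using this

/-- `freeMul` is the distribution of a product of any two free random variables. -/
theorem distribution_mul_of_freePair {A : Type*} [Ring A] [Algebra ℂ A] (φ : A →ₗ[ℂ] ℂ)
    (hφ : φ 1 = 1) (a b : A) (h : FreePair φ a b) :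
    distribution φ hφ (a * b) = freeMul (distribution φ hφ a) (distribution φ hφ b) := by
  apply distribution_ext
  intro n
  have := apply_freeAlgebra_of_freePair φ hφ a b h
    ((FreeAlgebra.ι ℂ 0 * FreeAlgebra.ι ℂ 1) ^ n)
  rw [freeMul, moment_distribution, moment_distribution]
  simpa using this

theorem moment_one_freeMul (μ ν : Distribution) :
    (freeMul μ ν).moment 1 = μ.moment 1 * ν.moment 1 := by
  rw [freeMul, moment_distribution]
  simp [vacuum_apply, freeVar, act, mul_comm]

end Facts

/-- Free multiplicative convolution on the distributions with mean `1`. -/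
def MeanOne.freeMul (μ ν : MeanOne) : MeanOne :=
  ⟨FreeProb.freeMul μ.1 ν.1, by rw [moment_one_freeMul, μ.2, ν.2, mul_one]⟩

/-! ## Voiculescu's transforms -/

/-- Removal of the constant term and division by `z`: `f ↦ (f(z) - f(0)) / z`. -/
def divX (f : ℂ⟦X⟧) : ℂ⟦X⟧ := PowerSeries.mk fun n => PowerSeries.coeff (n + 1) f

/-- The moment series `M_μ(z) = ∑_{n ≥ 0} m_n zⁿ`. -/
def momentSeries (μ : Distribution) : ℂ⟦X⟧ := PowerSeries.mk μ.moment

/-- The Cauchy transform `G_μ(w) = ∑_{n ≥ 0} m_n w^{-n-1}`, as a power series in `u = 1/w`. -/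
def cauchySeries (μ : Distribution) : ℂ⟦X⟧ := PowerSeries.X * momentSeries μ

theorem isUnit_coeff_one_cauchySeries (μ : Distribution) :
    IsUnit (PowerSeries.coeff 1 (cauchySeries μ)) := by
  rw [cauchySeries, ← zero_add 1, PowerSeries.coeff_succ_X_mul]
  simp [momentSeries, moment_zero]

/-- Voiculescu's `R`-transform, `R_μ(z) = K(z) - 1/z`, where `K` is the compositional inverse of the
Cauchy transform. In terms of the compositional inverse `c(z) = z d(z)` of `cauchySeries μ`
one has `K = 1/c`, so that `R_μ(z) = (1/d(z) - 1)/z`. -/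
def rTransform (μ : Distribution) : ℂ⟦X⟧ :=
  divX (divX ((cauchySeries μ).substInvOfIsUnit (isUnit_coeff_one_cauchySeries μ)))⁻¹

/-- `ψ_μ(z) = ∑_{n ≥ 1} m_n zⁿ`. -/
def psi (μ : Distribution) : ℂ⟦X⟧ := momentSeries μ - 1

theorem isUnit_coeff_one_psi (μ : MeanOne) : IsUnit (PowerSeries.coeff 1 (psi μ.1)) := by
  have h := μ.2
  simp [psi, momentSeries, PowerSeries.coeff_one, h]

/-- The compositional inverse `χ_μ` of `ψ_μ`. -/
def chi (μ : MeanOne) : ℂ⟦X⟧ := (psi μ.1).substInvOfIsUnit (isUnit_coeff_one_psi μ)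

/-- `Λ(ℂ) = 1 + z ℂ⟦z⟧` with the multiplication of power series. -/
abbrev Lam : Submonoid ℂ⟦X⟧ := MonoidHom.mker (PowerSeries.constantCoeff (R := ℂ))

/-- Voiculescu's `S`-transform `S_μ(z) = χ_μ(z) (1 + z) / z`, an element of `Λ(ℂ)`. -/
def sTransform (μ : MeanOne) : Lam :=
  ⟨divX (chi μ) * (1 + PowerSeries.X), by
    have h := μ.2
    have h1 : PowerSeries.coeff 1 (psi μ.1) = 1 := by
      simp [psi, momentSeries, PowerSeries.coeff_one, h]
    have h2 : ((isUnit_coeff_one_psi μ).unit⁻¹ : ℂˣ) = 1 :=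
      inv_eq_one.2 (Units.ext (by simp [h1]))
    have h3 : PowerSeries.constantCoeff (divX (chi μ)) = PowerSeries.coeff 1 (chi μ) := by
      rw [← PowerSeries.coeff_zero_eq_constantCoeff_apply, divX, PowerSeries.coeff_mk]
    rw [MonoidHom.mem_mker, map_mul, h3, chi, PowerSeries.coeff_one_substInvOfIsUnit, h2]
    simp⟩

theorem X_mul_divX {f : ℂ⟦X⟧} (hf : PowerSeries.constantCoeff f = 0) :
    PowerSeries.X * divX f = f := by
  ext n
  cases n with
  | zero => simp [hf]
  | succ n => simp [divX, PowerSeries.coeff_succ_X_mul]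

/-- `ψ_μ(χ_μ(z)) = z`. -/
theorem psi_subst_chi (μ : MeanOne) : (psi μ.1).subst (chi μ) = PowerSeries.X :=
  PowerSeries.subst_substInvOfIsUnit_right _ (by
    rw [← PowerSeries.coeff_zero_eq_constantCoeff_apply]
    simp only [psi, momentSeries, map_sub, PowerSeries.coeff_mk, PowerSeries.coeff_zero_one,
      moment_zero, sub_self]) _

/-- `z S_μ(z) = χ_μ(z) (1 + z)`. -/
theorem X_mul_sTransform (μ : MeanOne) :
    PowerSeries.X * (sTransform μ : ℂ⟦X⟧) = chi μ * (1 + PowerSeries.X) := by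
  simp only [sTransform]
  rw [← mul_assoc, X_mul_divX (by simp [chi])]

/-- `G_μ(R_μ(z) + 1/z) = z`, with `G_μ` written as a series in the inverse
`(R_μ(z) + 1/z)⁻¹ = z (1 + z R_μ(z))⁻¹` of its argument. -/
theorem cauchySeries_subst (μ : Distribution) :
    (cauchySeries μ).subst (PowerSeries.X * (1 + PowerSeries.X * rTransform μ)⁻¹) =
      PowerSeries.X := by
  have key := PowerSeries.subst_substInvOfIsUnit_right (cauchySeries μ) (by simp [cauchySeries])
    (isUnit_coeff_one_cauchySeries μ)
  have hc1 := PowerSeries.coeff_one_substInvOfIsUnit (cauchySeries μ)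
    (isUnit_coeff_one_cauchySeries μ)
  have hc0 := PowerSeries.constantCoeff_substInvOfIsUnit (cauchySeries μ)
    (isUnit_coeff_one_cauchySeries μ)
  unfold rTransform
  generalize (cauchySeries μ).substInvOfIsUnit (isUnit_coeff_one_cauchySeries μ) = c at key hc1 hc0 ⊢
  have h1 : PowerSeries.coeff 1 (cauchySeries μ) = 1 := by
    rw [cauchySeries, ← zero_add 1, PowerSeries.coeff_succ_X_mul]
    simp only [momentSeries, PowerSeries.coeff_mk, moment_zero]
  have hu : ((isUnit_coeff_one_cauchySeries μ).unit⁻¹ : ℂˣ) = 1 :=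
    inv_eq_one.2 (Units.ext (by simp [h1]))
  have hd : PowerSeries.constantCoeff (divX c) = 1 := by
    rw [← PowerSeries.coeff_zero_eq_constantCoeff_apply, divX, PowerSeries.coeff_mk, zero_add, hc1,
      hu, Units.val_one]
  have hinv : 1 + PowerSeries.X * divX (divX c)⁻¹ = (divX c)⁻¹ := by
    have h2 : divX (divX c)⁻¹ = divX ((divX c)⁻¹ - 1) := by
      ext n
      simp [divX, PowerSeries.coeff_one]
    rw [h2, X_mul_divX (by simp [hd])]
    ring
  have hii : ((divX c)⁻¹)⁻¹ = divX c := by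
    rw [PowerSeries.inv_eq_iff_mul_eq_one (by simp [hd])]
    exact PowerSeries.mul_inv_cancel _ (by simp [hd])
  rw [hinv, hii, X_mul_divX hc0, key]

/-- The ghost map `d/dz log : Λ(ℂ) → ℂ⟦z⟧`. -/
def ghostMap (f : Lam) : ℂ⟦X⟧ := PowerSeries.derivative ℂ (PowerSeries.logOf (f : ℂ⟦X⟧))

end

end FreeProb

namespace FreeProb

noncomputable section

/-! ## Series with coefficients in a noncommutative probability space -/

section Series

variable {A : Type*} [Ring A] [Algebra ℂ A]

/-! Everything rests on the bijectivity of the three transforms and on the additivity of R and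
multiplicativity of S under free convolution. Bijectivity is formal: each distribution transform is
a compositional inverse, hence reversible, and `ghostMap` is the logarithmic derivative, inverted by
integrating and exponentiating. The group axioms are then transported from `Lam` and ℂ⟦X⟧.

The additivity of R and the multiplicativity of S come from resolvents in A⟦X⟧. For the sum, take
P_a = (1 + X R_a - X a)⁻¹. The equation defining R_a says E(P_a) = 1, so P_a = 1 + X e_a with e_a
centred. Algebra gives (1 + X(R_a + R_b) - X(a+b))⁻¹ = P_b T P_a with T = (1 - X² e_a e_b)⁻¹.
Expanding T as a geometric series leaves only 1 and alternating centred words, which freeness kills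
(`expect_sandwich`). So the expectation is 1, which identifies the R-transform of a+b.

For the product, put y = 1 + X and use Q_a = (1 - χ_a a)⁻¹ = y + X e_a. With χ = χ_a χ_b y / X one
finds (1 - χ ab)⁻¹ = y⁻¹ Q_b T Q_a, now with T = (1 - X y⁻¹ e_a e_b)⁻¹. Its expectation is y, so χ =
χ_ab. `expect_resolvent` translates these expectations into the moment series. -/

/-- Series with scalar coefficients act on series with coefficients in an algebra. -/
abbrev seriesAlgebra : Algebra ℂ⟦X⟧ A⟦X⟧ :=
  (PowerSeries.map (algebraMap ℂ A)).toAlgebra' fun c x => by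
    ext n
    rw [PowerSeries.coeff_mul, PowerSeries.coeff_mul, ← Finset.Nat.sum_antidiagonal_swap]
    exact Finset.sum_congr rfl fun p _ => by simpa using Algebra.commutes _ _

attribute [local instance] seriesAlgebra

theorem coeff_series_smul (n : ℕ) (c : ℂ⟦X⟧) (f : A⟦X⟧) :
    PowerSeries.coeff n (c • f) = ∑ p ∈ Finset.HasAntidiagonal.antidiagonal n,
      PowerSeries.coeff p.1 c • PowerSeries.coeff p.2 f := by
  rw [Algebra.smul_def, PowerSeries.coeff_mul]
  refine Finset.sum_congr rfl fun p _ => ?_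
  rw [Algebra.smul_def]
  rfl

theorem X_smul_series (f : A⟦X⟧) : (PowerSeries.X : ℂ⟦X⟧) • f = PowerSeries.X * f := by
  rw [Algebra.smul_def]
  congr 1
  exact PowerSeries.map_X _

theorem constantCoeff_X_smul (f : A⟦X⟧) :
    PowerSeries.constantCoeff ((PowerSeries.X : ℂ⟦X⟧) • f) = 0 := by
  simp [X_smul_series]

theorem constantCoeff_series_smul_one {c : ℂ⟦X⟧} (hc : PowerSeries.constantCoeff c = 1) :
    PowerSeries.constantCoeff (c • (1 : A⟦X⟧)) = 1 := by
  rw [← PowerSeries.coeff_zero_eq_constantCoeff_apply, coeff_series_smul]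
  simp [hc]

/-- The coefficientwise expectation. -/
def expect (φ : A →ₗ[ℂ] ℂ) : A⟦X⟧ →ₗ[ℂ⟦X⟧] ℂ⟦X⟧ where
  toFun f := PowerSeries.mk fun n => φ (PowerSeries.coeff n f)
  map_add' f g := by ext n; simp
  map_smul' c f := by
    ext n
    simp [coeff_series_smul, PowerSeries.coeff_mul]

theorem coeff_expect (φ : A →ₗ[ℂ] ℂ) (f : A⟦X⟧) (n : ℕ) :
    PowerSeries.coeff n (expect φ f) = φ (PowerSeries.coeff n f) := by
  simp [expect]

theorem expect_C (φ : A →ₗ[ℂ] ℂ) (x : A) :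
    expect φ (PowerSeries.C x) = PowerSeries.C (φ x) := by
  ext n
  rw [coeff_expect, PowerSeries.coeff_C, PowerSeries.coeff_C]
  split_ifs <;> simp

theorem expect_one {φ : A →ₗ[ℂ] ℂ} (hφ : φ 1 = 1) : expect φ 1 = 1 := by
  simpa [hφ] using expect_C φ 1

theorem eq_zero_of_forall_X_pow_dvd {f : ℂ⟦X⟧} (h : ∀ n, PowerSeries.X ^ n ∣ f) : f = 0 := by
  ext n
  exact PowerSeries.X_pow_dvd_iff.1 (h (n + 1)) n n.lt_succ_self

/-- The expectation of the resolvent `(1 - c a)⁻¹` is the moment series of `a` at `c`. -/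
theorem expect_resolvent (φ : A →ₗ[ℂ] ℂ) (hφ : φ 1 = 1) (a : A) {c : ℂ⟦X⟧}
    (hc : PowerSeries.constantCoeff c = 0) {Q : A⟦X⟧}
    (hQ : Q * (1 - c • PowerSeries.C a) = 1) :
    expect φ Q = (momentSeries (distribution φ hφ a)).subst c := by
  have hs : PowerSeries.HasSubst c := PowerSeries.HasSubst.of_constantCoeff_zero' hc
  -- E(Q aᵏ) and the k-shifted moment series at c solve the same recursion f k = φ(aᵏ) + c · f
  -- (k+1). Each use of it gains a factor X, since c has no constant term. The recursion raises k,
  -- so all k are treated at once.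
  set F : ℕ → ℂ⟦X⟧ := fun k => expect φ (Q * PowerSeries.C (a ^ k)) with hF
  set m : ℕ → ℂ⟦X⟧ := fun k => PowerSeries.mk fun n => φ (a ^ (n + k)) with hm
  have hFs : ∀ k, F k = PowerSeries.C (φ (a ^ k)) + c * F (k + 1) := by
    intro k
    have h1 : Q = 1 + c • (Q * PowerSeries.C a) := by
      rw [mul_sub, mul_one, mul_smul_comm] at hQ
      rw [← hQ, sub_add_cancel]
    simp only [hF]
    conv_lhs => rw [h1]
    rw [add_mul, one_mul, map_add, expect_C, smul_mul_assoc, map_smul, smul_eq_mul, mul_assoc,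
      ← map_mul, ← pow_succ']
  have hms : ∀ k, m k = PowerSeries.C (φ (a ^ k)) + PowerSeries.X * m (k + 1) := by
    intro k
    ext n
    cases n with
    | zero => simp [hm]
    | succ n => simp [hm, PowerSeries.coeff_succ_X_mul, add_right_comm, add_assoc]
  have hGs : ∀ k, (m k).subst c = PowerSeries.C (φ (a ^ k)) + c * (m (k + 1)).subst c := by
    intro k
    conv_lhs => rw [hms k]
    rw [PowerSeries.subst_add hs, PowerSeries.subst_mul hs, PowerSeries.subst_X hs]
    congr 1
    exact PowerSeries.subst_C _
  have hd : ∀ n k, PowerSeries.X ^ n ∣ F k - (m k).subst c := by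
    intro n
    induction n with
    | zero => simp
    | succ n ih =>
      intro k
      rw [hFs, hGs, add_sub_add_left_eq_sub, ← mul_sub, pow_succ']
      exact mul_dvd_mul (PowerSeries.X_dvd_iff.2 hc) (ih _)
  have h0 := eq_zero_of_forall_X_pow_dvd fun n => hd n 0
  have hM : momentSeries (distribution φ hφ a) = m 0 := by
    ext n
    simp [momentSeries, moment_distribution, hm]
  rw [hM, ← sub_eq_zero.1 h0]
  simp [hF]

/-- The recursion for the coefficients of an inverse uses only coefficients of f and earlier ones.
This keeps a resolvent of a inside the subalgebra of a, so that freeness applies to it. -/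
theorem coeff_invOfUnit_mem (B : Subalgebra ℂ A) {f : A⟦X⟧}
    (hf : ∀ n, PowerSeries.coeff n f ∈ B) (n : ℕ) :
    PowerSeries.coeff n (f.invOfUnit 1) ∈ B := by
  induction n using Nat.strong_induction_on with
  | _ n ih =>
    rw [PowerSeries.coeff_invOfUnit]
    split_ifs with h
    · simp
    · simp only [inv_one, Units.val_one, neg_mul, one_mul]
      refine neg_mem (sum_mem fun p hp => ?_)
      split_ifs with h2
      · exact mul_mem (hf _) (ih _ h2)
      · exact zero_mem _

theorem coeff_series_smul_mem (B : Subalgebra ℂ A) (c : ℂ⟦X⟧) {f : A⟦X⟧}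
    (hf : ∀ n, PowerSeries.coeff n f ∈ B) (n : ℕ) : PowerSeries.coeff n (c • f) ∈ B := by
  rw [coeff_series_smul]
  exact sum_mem fun p _ => B.smul_mem (hf _) _

theorem coeff_C_mem (B : Subalgebra ℂ A) {x : A} (hx : x ∈ B) (n : ℕ) :
    PowerSeries.coeff n (PowerSeries.C x) ∈ B := by
  rw [PowerSeries.coeff_C]
  split_ifs
  exacts [hx, zero_mem _]

theorem coeff_one_mem (B : Subalgebra ℂ A) (n : ℕ) :
    PowerSeries.coeff n (1 : A⟦X⟧) ∈ B := by
  simpa using coeff_C_mem B B.one_mem n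

/-! ### Centred series and alternating words -/

/-- A series of elements of `B` with expectation zero. -/
def IsCentred (φ : A →ₗ[ℂ] ℂ) (B : Subalgebra ℂ A) (f : A⟦X⟧) : Prop :=
  (∀ n, PowerSeries.coeff n f ∈ B) ∧ expect φ f = 0

theorem IsCentred.smul {φ : A →ₗ[ℂ] ℂ} {B : Subalgebra ℂ A} {f : A⟦X⟧} (hf : IsCentred φ B f)
    (c : ℂ⟦X⟧) : IsCentred φ B (c • f) :=
  ⟨coeff_series_smul_mem B c hf.1, by rw [map_smul, hf.2, smul_zero]⟩

/-- A product of centred series from neighbouring different free subalgebras has expectation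
zero. -/
theorem expect_prod_eq_zero {ι : Type*} {φ : A →ₗ[ℂ] ℂ} {B : ι → Subalgebra ℂ A} (hB : IsFree φ B)
    (l : List (ι × A⟦X⟧)) (hne : l ≠ []) (hl : (l.map Prod.fst).IsChain (· ≠ ·))
    (hc : ∀ p ∈ l, IsCentred φ (B p.1) p.2) : expect φ (l.map Prod.snd).prod = 0 := by
  -- Series are replaced by their coefficients one factor at a time: `w` holds the coefficients
  -- already chosen, `l` the series still to be expanded.
  have key : ∀ (l : List (ι × A⟦X⟧)) (w : List (ι × A)), w ++ l.map (fun p => (p.1, 0)) ≠ [] →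
      (w.map Prod.fst ++ l.map Prod.fst).IsChain (· ≠ ·) →
      (∀ p ∈ l, IsCentred φ (B p.1) p.2) → (∀ p ∈ w, p.2 ∈ B p.1 ∧ φ p.2 = 0) →
      ∀ n, φ ((w.map Prod.snd).prod * PowerSeries.coeff n (l.map Prod.snd).prod) = 0 := by
    intro l
    induction l with
    | nil =>
      intro w hw hwc _ hm n
      have h0 := hB w (by simpa using hw) (by simpa [List.isChain_map] using hwc) hm
      by_cases hn : n = 0 <;> simp [PowerSeries.coeff_one, hn, h0]
    | cons q l ih =>
      intro w _ hwc hl hm n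
      simp only [List.map_cons, List.prod_cons, PowerSeries.coeff_mul, Finset.mul_sum, map_sum]
      refine Finset.sum_eq_zero fun p _ => ?_
      have hq := hl q (by simp)
      have := ih (w ++ [(q.1, PowerSeries.coeff p.1 q.2)]) (by simp) (by simpa using hwc)
        (fun p hp => hl p (List.mem_cons_of_mem _ hp)) (by
          intro r hr
          rcases List.mem_append.1 hr with hr | hr
          · exact hm r hr
          · obtain rfl := List.mem_singleton.1 hr
            refine ⟨hq.1 _, ?_⟩
            rw [← coeff_expect, hq.2, map_zero]) p.2
      simpa [mul_assoc] using this
  ext n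
  rw [coeff_expect]
  simpa using key l [] (by simpa using hne) (by simpa using hl) hc (by simp) n

/-- T is the geometric series in X g e₀ e₁. Unfolding it once leaves an alternating centred word
plus X times an expression of the same shape with a longer `l`, so the expectation is divisible by
every power of X. -/
theorem expect_geometric_eq_zero {φ : A →ₗ[ℂ] ℂ} {B : Fin 2 → Subalgebra ℂ A} (hB : IsFree φ B)
    {e₀ e₁ T : A⟦X⟧} (h₀ : IsCentred φ (B 0) e₀) (h₁ : IsCentred φ (B 1) e₁) {g : ℂ⟦X⟧}
    (hT : T = 1 + (PowerSeries.X * g) • (e₀ * e₁ * T)) (r : List (Fin 2 × A⟦X⟧))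
    (hr : r = [] ∨ ∃ f, IsCentred φ (B 0) f ∧ r = [(0, f)])
    (l : List (Fin 2 × A⟦X⟧)) (hne : l ≠ []) (hl : (l.map Prod.fst ++ [0]).IsChain (· ≠ ·))
    (hc : ∀ p ∈ l, IsCentred φ (B p.1) p.2) :
    expect φ ((l.map Prod.snd).prod * T * (r.map Prod.snd).prod) = 0 := by
  refine eq_zero_of_forall_X_pow_dvd fun n => ?_
  induction n generalizing l with
  | zero => simp
  | succ n ih =>
    have h1 : expect φ ((l.map Prod.snd).prod * (r.map Prod.snd).prod) = 0 := by
      have := expect_prod_eq_zero hB (l ++ r) (by simp [hne]) (by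
        rcases hr with rfl | ⟨f, -, rfl⟩
        · simpa using hl.left_of_append
        · simpa using hl) (by
        intro p hp
        rcases List.mem_append.1 hp with hp | hp
        · exact hc p hp
        · rcases hr with rfl | ⟨f, hf, rfl⟩
          · simp at hp
          · obtain rfl := List.mem_singleton.1 hp
            exact hf)
      simpa using this
    -- The new left word ends in index 1, so it may again be followed by index 0.
    have h2 := ih (l ++ [(0, e₀), (1, e₁)]) (by simp) (by
      have : l.map Prod.fst ++ [(0 : Fin 2), 1, 0] = (l.map Prod.fst ++ [0]) ++ [1, 0] := by simp
      simp only [List.map_append, List.map_cons, List.map_nil, List.append_assoc, List.cons_append,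
        List.nil_append]
      rw [this, List.isChain_append]
      refine ⟨hl, by simp, by simp⟩) (by
      intro p hp
      simp only [List.mem_append, List.mem_cons, List.not_mem_nil, or_false] at hp
      rcases hp with hp | rfl | rfl
      exacts [hc p hp, h₀, h₁])
    rw [hT, mul_add, mul_one, add_mul, map_add, h1, zero_add, mul_smul_comm, smul_mul_assoc,
      map_smul, smul_eq_mul, mul_assoc PowerSeries.X, pow_succ']
    refine mul_dvd_mul_left _ (Dvd.dvd.mul_left ?_ _)
    simpa [mul_assoc] using h2

/-- After expansion of T, every term other than α β is a multiple of an alternating centred word: f₁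
fits before e₀ and f₀ fits after e₁. Both convolution formulas use this, with g = X for sums and g =
(1 + X)⁻¹ for products. -/
theorem expect_sandwich {φ : A →ₗ[ℂ] ℂ} (hφ : φ 1 = 1) {B : Fin 2 → Subalgebra ℂ A}
    (hB : IsFree φ B) {e₀ e₁ f₀ f₁ T : A⟦X⟧} (h₀ : IsCentred φ (B 0) e₀)
    (h₁ : IsCentred φ (B 1) e₁) (hf₀ : IsCentred φ (B 0) f₀) (hf₁ : IsCentred φ (B 1) f₁)
    {g : ℂ⟦X⟧} (hT : T = 1 + (PowerSeries.X * g) • (e₀ * e₁ * T)) (α β : ℂ⟦X⟧) :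
    expect φ ((α • 1 + f₁) * T * (β • 1 + f₀)) = α * β := by
  have key := expect_geometric_eq_zero hB h₀ h₁ hT
  have e1 := key [] (.inl rfl) [(1, f₁)] (by simp) (by simp) (by simpa using hf₁)
  have e2 := key [(0, f₀)] (.inr ⟨_, hf₀, rfl⟩) [(1, f₁)] (by simp) (by simp) (by simpa using hf₁)
  have e3 := key [] (.inl rfl) [(0, e₀), (1, e₁)] (by simp) (by simp) (by simpa using ⟨h₀, h₁⟩)
  have e4 := key [(0, f₀)] (.inr ⟨_, hf₀, rfl⟩) [(0, e₀), (1, e₁)] (by simp) (by simp)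
    (by simpa using ⟨h₀, h₁⟩)
  simp only [List.map_cons, List.map_nil, List.prod_cons, List.prod_nil, mul_one] at e1 e2 e3 e4
  -- With an empty left word `expect_geometric_eq_zero` does not apply, so T is first unfolded once.
  have e5 : expect φ T = 1 := by
    rw [hT, map_add, map_smul, e3, expect_one hφ, smul_zero, add_zero]
  have e6 : expect φ (T * f₀) = 0 := by
    rw [hT, add_mul, map_add, smul_mul_assoc, map_smul, e4, one_mul, hf₀.2, smul_zero, add_zero]
  simp only [add_mul, mul_add, smul_mul_assoc, mul_smul_comm, one_mul, mul_one, map_add, map_smul,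
    e1, e2, e5, e6, smul_eq_mul]
  ring

end Series

/-! ## Characterization of the transforms -/

theorem constantCoeff_momentSeries (μ : Distribution) :
    PowerSeries.constantCoeff (momentSeries μ) = 1 := by
  rw [← PowerSeries.coeff_zero_eq_constantCoeff_apply, momentSeries, PowerSeries.coeff_mk,
    moment_zero]

theorem constantCoeff_cauchySeries (μ : Distribution) :
    PowerSeries.constantCoeff (cauchySeries μ) = 0 := by simp [cauchySeries]

theorem constantCoeff_psi (μ : Distribution) : PowerSeries.constantCoeff (psi μ) = 0 := by
  simp [psi, constantCoeff_momentSeries]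

/-- Right inverses for composition are unique. -/
theorem eq_substInvOfIsUnit {f c : ℂ⟦X⟧} (hf : PowerSeries.constantCoeff f = 0)
    (hu : IsUnit (PowerSeries.coeff 1 f)) (hc : PowerSeries.constantCoeff c = 0)
    (h : f.subst c = PowerSeries.X) : c = f.substInvOfIsUnit hu := by
  have hs := PowerSeries.HasSubst.of_constantCoeff_zero' hc
  have hsf := PowerSeries.HasSubst.of_constantCoeff_zero' hf
  have := PowerSeries.subst_comp_subst_apply hsf hs (f.substInvOfIsUnit hu)
  rw [PowerSeries.subst_substInvOfIsUnit_left f hf hu, PowerSeries.subst_X hs, h,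
    PowerSeries.X_subst] at this
  exact this

/-- Left inverses for composition are unique. -/
theorem eq_of_subst_eq_X {f g c : ℂ⟦X⟧} (hc : PowerSeries.constantCoeff c = 0)
    (hu : IsUnit (PowerSeries.coeff 1 c)) (hf : f.subst c = PowerSeries.X)
    (hg : g.subst c = PowerSeries.X) : f = g := by
  have hs := PowerSeries.HasSubst.of_constantCoeff_zero' hc
  have hi := PowerSeries.HasSubst.substInvOfIsUnit c hu
  have e := congrArg (fun s : ℂ⟦X⟧ => s.subst (c.substInvOfIsUnit hu)) (hf.trans hg.symm)
  simp only [PowerSeries.subst_comp_subst_apply hs hi,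
    PowerSeries.subst_substInvOfIsUnit_right c hc hu, PowerSeries.X_subst] at e
  exact e

/-- The distribution with given moments. -/
def ofMoments (m : ℕ → ℂ) (hm : m 0 = 1) : Distribution :=
  ⟨(Polynomial.basisMonomials ℂ).constr ℂ m, by
    have := (Polynomial.basisMonomials ℂ).constr_basis ℂ m 0
    simpa [hm] using this⟩

theorem moment_ofMoments (m : ℕ → ℂ) (hm : m 0 = 1) (n : ℕ) : (ofMoments m hm).moment n = m n := by
  have := (Polynomial.basisMonomials ℂ).constr_basis ℂ m n
  simpa [Distribution.moment, ofMoments, Polynomial.X_pow_eq_monomial] using this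

theorem exists_momentSeries_eq {f : ℂ⟦X⟧} (hf : PowerSeries.constantCoeff f = 1) :
    ∃ μ : Distribution, momentSeries μ = f := by
  refine ⟨ofMoments (fun n => PowerSeries.coeff n f) (by simpa using hf), ?_⟩
  ext n
  simp [momentSeries, moment_ofMoments]

theorem momentSeries_injective : Function.Injective momentSeries := by
  intro μ ν h
  refine distribution_ext fun n => ?_
  simpa [momentSeries] using congrArg (PowerSeries.coeff n) h

theorem cauchySeries_injective : Function.Injective cauchySeries := fun _ _ h =>
  momentSeries_injective (mul_left_cancel₀ PowerSeries.X_ne_zero h)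

theorem psi_injective : Function.Injective psi := fun _ _ h =>
  momentSeries_injective (sub_left_injective h)

theorem constantCoeff_one_add_X_mul (r : ℂ⟦X⟧) :
    PowerSeries.constantCoeff (1 + PowerSeries.X * r) = 1 := by simp

theorem constantCoeff_X_mul (r : ℂ⟦X⟧) :
    PowerSeries.constantCoeff (PowerSeries.X * r) = 0 := by simp

/-- The compositional inverse of the Cauchy series is unique, and r can be read off from X(1 + X
r)⁻¹. -/
theorem rTransform_eq_of_subst {μ : Distribution} {r : ℂ⟦X⟧}
    (h : (cauchySeries μ).subst (PowerSeries.X * (1 + PowerSeries.X * r)⁻¹) = PowerSeries.X) :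
    rTransform μ = r := by
  have e1 := eq_substInvOfIsUnit (constantCoeff_cauchySeries μ)
    (isUnit_coeff_one_cauchySeries μ) (by simp) h
  have e2 := eq_substInvOfIsUnit (constantCoeff_cauchySeries μ)
    (isUnit_coeff_one_cauchySeries μ) (by simp) (cauchySeries_subst μ)
  have e3 := mul_left_cancel₀ PowerSeries.X_ne_zero (e2.trans e1.symm)
  have h1 := PowerSeries.mul_inv_cancel (1 + PowerSeries.X * r) (by simp)
  have h2 := PowerSeries.mul_inv_cancel (1 + PowerSeries.X * rTransform μ) (by simp)
  rw [e3] at h2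
  have h0 : (1 + PowerSeries.X * r)⁻¹ ≠ 0 := fun h => by simp [h] at h1
  exact mul_left_cancel₀ PowerSeries.X_ne_zero
    (add_left_cancel (mul_right_cancel₀ h0 (h2.trans h1.symm)))

/-- This is uniqueness of the compositional inverse of ψ, stated for 1 + ψ because expectations of
resolvents produce the full moment series. -/
theorem chi_eq_of_subst {μ : MeanOne} {c : ℂ⟦X⟧} (hc : PowerSeries.constantCoeff c = 0)
    (h : (momentSeries μ.1).subst c = 1 + PowerSeries.X) : chi μ = c := by
  refine (eq_substInvOfIsUnit (constantCoeff_psi _) (isUnit_coeff_one_psi μ) hc ?_).symm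
  have hs := PowerSeries.HasSubst.of_constantCoeff_zero' hc
  have h1 : (1 : ℂ⟦X⟧).subst c = 1 := by
    rw [← PowerSeries.coe_substAlgHom hs, map_one]
  rw [psi, PowerSeries.subst_sub hs, h, h1, add_sub_cancel_left]

theorem constantCoeff_chi (μ : MeanOne) : PowerSeries.constantCoeff (chi μ) = 0 := by simp [chi]

theorem momentSeries_subst_chi (μ : MeanOne) :
    (momentSeries μ.1).subst (chi μ) = 1 + PowerSeries.X := by
  have hs := PowerSeries.HasSubst.of_constantCoeff_zero' (constantCoeff_chi μ)
  have h1 : (1 : ℂ⟦X⟧).subst (chi μ) = 1 := by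
    rw [← PowerSeries.coe_substAlgHom hs, map_one]
  have h2 := psi_subst_chi μ
  rw [psi, PowerSeries.subst_sub hs, h1, sub_eq_iff_eq_add] at h2
  rw [h2, add_comm]

/-! ## Bijectivity of the transforms -/

theorem isUnit_coeff_one_X_mul {f : ℂ⟦X⟧} (hf : PowerSeries.constantCoeff f = 1) :
    IsUnit (PowerSeries.coeff 1 (PowerSeries.X * f)) := by
  rw [← zero_add 1, PowerSeries.coeff_succ_X_mul]
  simp [hf]

theorem constantCoeff_inv_eq_one {f : ℂ⟦X⟧} (hf : PowerSeries.constantCoeff f = 1) :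
    PowerSeries.constantCoeff f⁻¹ = 1 := by simp [hf]

theorem constantCoeff_divX (f : ℂ⟦X⟧) :
    PowerSeries.constantCoeff (divX f) = PowerSeries.coeff 1 f := by
  rw [← PowerSeries.coeff_zero_eq_constantCoeff_apply, divX, PowerSeries.coeff_mk]

theorem coeff_one_substInv {f : ℂ⟦X⟧} (hf : PowerSeries.coeff 1 f = 1)
    (hu : IsUnit (PowerSeries.coeff 1 f)) : PowerSeries.coeff 1 (f.substInvOfIsUnit hu) = 1 := by
  rw [PowerSeries.coeff_one_substInvOfIsUnit]
  simp [inv_eq_one.2 (Units.ext hf : hu.unit = 1)]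

/-- The Cauchy series is the compositional inverse of X(1 + X r)⁻¹. Hence r determines it, and any r
yields one with linear coefficient 1, that is, with zeroth moment 1. -/
theorem rTransform_bijective : Function.Bijective rTransform := by
  constructor
  · intro μ ν h
    have hν := cauchySeries_subst ν
    rw [← h] at hν
    exact cauchySeries_injective (eq_of_subst_eq_X (constantCoeff_X_mul _)
      (isUnit_coeff_one_X_mul (constantCoeff_inv_eq_one (constantCoeff_one_add_X_mul _)))
      (cauchySeries_subst μ) hν)
  · intro r
    set c : ℂ⟦X⟧ := PowerSeries.X * (1 + PowerSeries.X * r)⁻¹ with hc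
    have hc1 : PowerSeries.coeff 1 c = 1 := by
      rw [hc, ← zero_add 1, PowerSeries.coeff_succ_X_mul]
      simp
    have hu : IsUnit (PowerSeries.coeff 1 c) := by simp [hc1]
    obtain ⟨μ, hμ⟩ := exists_momentSeries_eq (f := divX (c.substInvOfIsUnit hu)) (by
      rw [constantCoeff_divX, coeff_one_substInv hc1])
    refine ⟨μ, rTransform_eq_of_subst ?_⟩
    rw [cauchySeries, hμ, X_mul_divX (by simp)]
    exact PowerSeries.subst_substInvOfIsUnit_left c (by simp [hc]) hu

/-- X S = χ (1 + X) recovers χ from S, and ψ is the compositional inverse of χ. -/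
theorem sTransform_bijective : Function.Bijective sTransform := by
  constructor
  · intro μ ν h
    have h1 := X_mul_sTransform μ
    rw [h, X_mul_sTransform ν] at h1
    have h0 : (1 + PowerSeries.X : ℂ⟦X⟧) ≠ 0 := fun h => by
      simpa using congrArg PowerSeries.constantCoeff h
    have h2 := mul_right_cancel₀ h0 h1
    have hν := psi_subst_chi ν
    rw [h2] at hν
    have hu : IsUnit (PowerSeries.coeff 1 (chi μ)) := by
      rw [chi, PowerSeries.coeff_one_substInvOfIsUnit]
      exact Units.isUnit _
    exact Subtype.ext (psi_injective
      (eq_of_subst_eq_X (constantCoeff_chi μ) hu (psi_subst_chi μ) hν))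
  · intro f
    have hf : PowerSeries.constantCoeff (f : ℂ⟦X⟧) = 1 := f.2
    set c : ℂ⟦X⟧ := PowerSeries.X * ((f : ℂ⟦X⟧) * (1 + PowerSeries.X)⁻¹) with hc
    have hc1 : PowerSeries.coeff 1 c = 1 := by
      rw [hc, ← zero_add 1, PowerSeries.coeff_succ_X_mul]
      simp [hf]
    have hu : IsUnit (PowerSeries.coeff 1 c) := by simp [hc1]
    have hc0 : PowerSeries.constantCoeff c = 0 := by simp [hc]
    obtain ⟨μ, hμ⟩ := exists_momentSeries_eq (f := 1 + c.substInvOfIsUnit hu) (by simp)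
    have hs := PowerSeries.HasSubst.of_constantCoeff_zero' hc0
    have h1 : (1 : ℂ⟦X⟧).subst c = 1 := by
      rw [← PowerSeries.coe_substAlgHom hs, map_one]
    -- The mean is 1 because c, and so its compositional inverse, has linear coefficient 1.
    let ν : MeanOne := ⟨μ, by
      have := congrArg (PowerSeries.coeff 1) hμ
      simpa [momentSeries, coeff_one_substInv hc1, PowerSeries.coeff_one] using this⟩
    have hχ : chi ν = c := chi_eq_of_subst hc0 (by
      rw [show momentSeries ν.1 = _ from hμ, PowerSeries.subst_add hs, h1,
        PowerSeries.subst_substInvOfIsUnit_left c hc0 hu])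
    refine ⟨ν, Subtype.ext (mul_left_cancel₀ PowerSeries.X_ne_zero ?_)⟩
    rw [X_mul_sTransform, hχ, hc, mul_assoc, mul_assoc, PowerSeries.inv_mul_cancel _ (by simp),
      mul_one]

/-! ## The ghost map -/

/-- Substituting f - 1 into log'(X) · (1 + X) = 1 shows that `ghostMap f` is f'/f. From here on the
logarithm itself is not needed. -/
theorem ghostMap_mul_self (f : Lam) :
    ghostMap f * (f : ℂ⟦X⟧) = PowerSeries.derivative ℂ (f : ℂ⟦X⟧) := by
  have hf : PowerSeries.constantCoeff (f : ℂ⟦X⟧) = 1 := f.2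
  have hs : PowerSeries.HasSubst ((f : ℂ⟦X⟧) - 1) :=
    PowerSeries.HasSubst.of_constantCoeff_zero' (by simp [hf])
  have hl : PowerSeries.derivative ℂ (PowerSeries.log ℂ) * (1 + PowerSeries.X) = 1 := by
    rw [PowerSeries.deriv_log]
    ext n
    cases n with
    | zero => simp
    | succ n => simp [mul_add, PowerSeries.coeff_succ_mul_X, PowerSeries.coeff_one, pow_succ]
  have h1 : (1 : ℂ⟦X⟧).subst ((f : ℂ⟦X⟧) - 1) = (1 : ℂ⟦X⟧) := by
    rw [← PowerSeries.coe_substAlgHom hs, map_one]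
  have h2 := congrArg (fun s : ℂ⟦X⟧ => s.subst ((f : ℂ⟦X⟧) - 1)) hl
  simp only [PowerSeries.subst_mul hs, PowerSeries.subst_add hs, h1, PowerSeries.subst_X hs,
    add_sub_cancel] at h2
  rw [ghostMap, PowerSeries.logOf_eq, PowerSeries.derivative_subst hs, mul_right_comm, h2, one_mul,
    map_sub]
  simp

theorem Lam.ne_zero (f : Lam) : (f : ℂ⟦X⟧) ≠ 0 := fun h => by
  have hf : PowerSeries.constantCoeff (f : ℂ⟦X⟧) = 1 := f.2
  simp [h] at hf

theorem ghostMap_mul (f g : Lam) : ghostMap (f * g) = ghostMap f + ghostMap g := by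
  refine mul_right_cancel₀ (Lam.ne_zero (f * g)) ?_
  rw [ghostMap_mul_self, Submonoid.coe_mul, Derivation.leibniz, ← ghostMap_mul_self,
    ← ghostMap_mul_self, smul_eq_mul, smul_eq_mul]
  ring

/-- If f and g have the same logarithmic derivative, f g⁻¹ has derivative zero and constant term 1.
A preimage of h is exp of a primitive of h. -/
theorem ghostMap_bijective : Function.Bijective ghostMap := by
  constructor
  · intro f g h
    have hf : PowerSeries.constantCoeff (f : ℂ⟦X⟧) = 1 := f.2
    have hg : PowerSeries.constantCoeff (g : ℂ⟦X⟧) = 1 := g.2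
    have hi := PowerSeries.mul_inv_cancel (g : ℂ⟦X⟧) (by simp [hg])
    have h1 : (f : ℂ⟦X⟧) * (g : ℂ⟦X⟧)⁻¹ = 1 := by
      refine PowerSeries.derivative.ext ?_ (by simp [hf, hg])
      rw [Derivation.leibniz, PowerSeries.derivative_inv', ← ghostMap_mul_self,
        ← ghostMap_mul_self, h, PowerSeries.derivative_one, smul_eq_mul, smul_eq_mul]
      linear_combination (-(f : ℂ⟦X⟧) * (g : ℂ⟦X⟧)⁻¹ * ghostMap g) * hi
    refine Subtype.ext ?_
    calc (f : ℂ⟦X⟧) = f * (g : ℂ⟦X⟧)⁻¹ * g := by rw [mul_assoc, mul_comm _ (g : ℂ⟦X⟧), hi, mul_one]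
      _ = g := by rw [h1, one_mul]
  · intro h
    -- The formal primitive of h. At n = 0 the division by zero returns 0, which is the constant
    -- term wanted.
    set H : ℂ⟦X⟧ := PowerSeries.mk fun n => PowerSeries.coeff (n - 1) h / n with hH
    have hH0 : PowerSeries.constantCoeff H = 0 := by
      rw [← PowerSeries.coeff_zero_eq_constantCoeff_apply]
      simp [hH]
    have hd : PowerSeries.derivative ℂ H = h := by
      ext n
      rw [PowerSeries.coeff_derivative, hH, PowerSeries.coeff_mk]
      have : (n : ℂ) + 1 ≠ 0 := by exact_mod_cast n.succ_ne_zero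
      simp [this]
    have hs := PowerSeries.HasSubst.of_constantCoeff_zero' hH0
    have he : PowerSeries.constantCoeff ((PowerSeries.exp ℂ).subst H) = 1 := by
      have h1 : PowerSeries.exp ℂ =
          1 + PowerSeries.X * divX (PowerSeries.exp ℂ - 1) := by
        rw [X_mul_divX (by simp)]
        ring
      have h3 : (1 : ℂ⟦X⟧).subst H = 1 := by
        rw [← PowerSeries.coe_substAlgHom hs, map_one]
      rw [h1, PowerSeries.subst_add hs, PowerSeries.subst_mul hs, PowerSeries.subst_X hs, h3,
        map_add, map_mul, hH0]
      simp
    refine ⟨⟨_, he⟩, ?_⟩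
    refine mul_right_cancel₀ (Lam.ne_zero ⟨_, he⟩) ?_
    rw [ghostMap_mul_self]
    simp only
    rw [PowerSeries.derivative_subst hs, hd, PowerSeries.derivative_exp, mul_comm]

/-! ## Free convolutions and the transforms -/

section AlgebraIdentities

variable {R S : Type*} [CommRing R] [Ring S] [Algebra R S]

/-- With P = 1 + x e and Q = 1 + x f this is 1 - (1 - P)(1 - Q) = P + Q - P Q. -/
theorem one_sub_smul_mul (x : R) (e f : S) : 1 - (x * x) • (e * f) =
    (1 + x • e) + (1 + x • f) - (1 + x • e) * (1 + x • f) := by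
  simp only [add_mul, mul_add, smul_mul_assoc, mul_smul_comm, one_mul, mul_one]
  module

theorem smul_one_sub_smul_add (x r s : R) (a b : S) :
    ((1 + x * r) • 1 - x • a) + ((1 + x * s) • 1 - x • b) - 1 =
      (1 + x * (r + s)) • 1 - x • (a + b) := by
  module

theorem smul_one_add_smul_sub_one (x : R) (e : S) :
    (1 + x) • 1 + x • e - 1 = x • (1 + e) := by
  module

/-- The terms linear in e and in f cancel; (1 + x) - x = 1 simplifies the other two coefficients. -/
theorem smul_one_add_smul_mul_sub (x : R) (e f : S) :
    ((1 + x) • 1 + x • e) * ((1 + x) • 1 + x • f) - (x * (1 + x)) • ((1 + e) * (1 + f)) =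
      (1 + x) • 1 - x • (e * f) := by
  simp only [add_mul, mul_add, smul_mul_assoc, mul_smul_comm, one_mul, mul_one]
  module

/-- Rescales an inverse of u - x a to the form 1 - c a, c = x u⁻¹, required by `expect_resolvent`.
-/
theorem smul_mul_one_sub_eq_one {x u v : R} (huv : u * v = 1) {P a : S}
    (hP : P * (u • 1 - x • a) = 1) : (u • P) * (1 - (x * v) • a) = 1 := by
  have h : u • (1 - (x * v) • a) = u • (1 : S) - x • a := by
    rw [smul_sub, smul_smul, mul_left_comm, huv, mul_one]
  rw [smul_mul_assoc, ← mul_smul_comm, h, hP]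

end AlgebraIdentities

/-! ### Resolvents of free sums and products -/

section Convolution

variable {A : Type*} [Ring A] [Algebra ℂ A]

attribute [local instance] seriesAlgebra

theorem exists_eq_X_smul {f : A⟦X⟧} (hf : PowerSeries.constantCoeff f = 0) :
    ∃ e : A⟦X⟧, f = (PowerSeries.X : ℂ⟦X⟧) • e ∧
      ∀ n, PowerSeries.coeff n e = PowerSeries.coeff (n + 1) f := by
  refine ⟨PowerSeries.mk fun n => PowerSeries.coeff (n + 1) f, ?_, by simp⟩
  rw [X_smul_series]
  ext n
  cases n with
  | zero => simpa using hf
  | succ n => simp [PowerSeries.coeff_succ_X_mul]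

/-- If the resolvent of `a` has scalar expectation `u`, it differs from `u` by `X` times a centred
series. -/
theorem exists_centred_of_resolvent {φ : A →ₗ[ℂ] ℂ} (hφ : φ 1 = 1) {B : Subalgebra ℂ A}
    {Q : A⟦X⟧} (hQB : ∀ n, PowerSeries.coeff n Q ∈ B) (hQ0 : PowerSeries.constantCoeff Q = 1)
    {u : ℂ⟦X⟧} (hu : PowerSeries.constantCoeff u = 1) (hQ : expect φ Q = u) :
    ∃ e, IsCentred φ B e ∧ Q = u • 1 + (PowerSeries.X : ℂ⟦X⟧) • e := by
  obtain ⟨e, he, hc⟩ := exists_eq_X_smul (f := Q - u • 1) (by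
    rw [map_sub, hQ0, constantCoeff_series_smul_one hu, sub_self])
  refine ⟨e, ⟨fun n => ?_, ?_⟩, by rw [← he, add_sub_cancel]⟩
  · rw [hc, map_sub]
    exact sub_mem (hQB _) (coeff_series_smul_mem B u (coeff_one_mem B) _)
  · have := congrArg (expect φ) he
    rw [map_sub, map_smul, map_smul, expect_one hφ, hQ, smul_eq_mul, mul_one, sub_self,
      smul_eq_mul] at this
    exact (mul_eq_zero.1 this.symm).resolve_left PowerSeries.X_ne_zero

theorem exists_inverse {f : A⟦X⟧} (hf : PowerSeries.constantCoeff f = 1) (B : Subalgebra ℂ A)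
    (hB : ∀ n, PowerSeries.coeff n f ∈ B) :
    ∃ g, f * g = 1 ∧ g * f = 1 ∧ PowerSeries.constantCoeff g = 1 ∧
      ∀ n, PowerSeries.coeff n g ∈ B :=
  ⟨f.invOfUnit 1, PowerSeries.mul_invOfUnit f 1 (by simpa using hf),
    PowerSeries.invOfUnit_mul f 1 (by simpa using hf), by simp, coeff_invOfUnit_mem B hB⟩

theorem constantCoeff_one_sub_smul {c : ℂ⟦X⟧} (hc : PowerSeries.constantCoeff c = 0) (f : A⟦X⟧) :
    PowerSeries.constantCoeff (1 - c • f) = 1 := by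
  rw [map_sub, map_one, ← PowerSeries.coeff_zero_eq_constantCoeff_apply, coeff_series_smul]
  simp [hc]

/-- The inverse of `1 + X r - X a` for the `R`-transform `r` of `a`. -/
theorem exists_additive_resolvent {φ : A →ₗ[ℂ] ℂ} (hφ : φ 1 = 1) {B : Subalgebra ℂ A} {a : A}
    (ha : a ∈ B) :
    ∃ P e Q : A⟦X⟧, Q = (1 + PowerSeries.X * rTransform (distribution φ hφ a)) • 1 -
        (PowerSeries.X : ℂ⟦X⟧) • PowerSeries.C a ∧
      P * Q = 1 ∧ Q * P = 1 ∧ IsCentred φ B e ∧ P = 1 + (PowerSeries.X : ℂ⟦X⟧) • e := by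
  set μ := distribution φ hφ a with hμ
  set u : ℂ⟦X⟧ := 1 + PowerSeries.X * rTransform μ with hu
  have hu0 : PowerSeries.constantCoeff u = 1 := constantCoeff_one_add_X_mul _
  have hui : u * u⁻¹ = 1 := PowerSeries.mul_inv_cancel _ (by simp [hu0])
  obtain ⟨P, hQP, hPQ, hP0, hPB⟩ := exists_inverse
    (f := u • (1 : A⟦X⟧) - (PowerSeries.X : ℂ⟦X⟧) • PowerSeries.C a)
    (by rw [map_sub, constantCoeff_series_smul_one hu0, constantCoeff_X_smul, sub_zero]) B
    (fun n => by
      rw [map_sub]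
      exact sub_mem (coeff_series_smul_mem B u (coeff_one_mem B) _)
        (coeff_series_smul_mem B _ (coeff_C_mem B ha) _))
  -- u P is the resolvent of a at X u⁻¹, so the equation G(R + 1/z) = z reads X u⁻¹ · E(u P) = X.
  have h1 : expect φ P = 1 := by
    have h2 := expect_resolvent φ hφ a (c := PowerSeries.X * u⁻¹) (constantCoeff_X_mul _)
      (Q := u • P) (smul_mul_one_sub_eq_one hui hPQ)
    have h3 := cauchySeries_subst μ
    have hs : PowerSeries.HasSubst (PowerSeries.X * u⁻¹) :=
      PowerSeries.HasSubst.of_constantCoeff_zero' (constantCoeff_X_mul _)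
    rw [cauchySeries, PowerSeries.subst_mul hs, PowerSeries.subst_X hs, ← h2, map_smul,
      smul_eq_mul] at h3
    refine mul_left_cancel₀ PowerSeries.X_ne_zero ?_
    calc PowerSeries.X * expect φ P = PowerSeries.X * (u * u⁻¹) * expect φ P := by
          rw [hui, mul_one]
      _ = PowerSeries.X * u⁻¹ * (u * expect φ P) := by ring
      _ = PowerSeries.X * 1 := by rw [h3, mul_one]
  obtain ⟨e, he, hPe⟩ := exists_centred_of_resolvent hφ hPB hP0 (map_one _) h1
  exact ⟨P, e, _, rfl, hPQ, hQP, he, by rw [hPe, one_smul]⟩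

theorem rTransform_add_of_isFree {φ : A →ₗ[ℂ] ℂ} (hφ : φ 1 = 1) {a b : A}
    (h : FreePair φ a b) : rTransform (distribution φ hφ (a + b)) =
      rTransform (distribution φ hφ a) + rTransform (distribution φ hφ b) := by
  obtain ⟨Pa, ea, Qa, hQa, hPQa, hQPa, hea, hPea⟩ := exists_additive_resolvent hφ
    (Algebra.subset_adjoin (Set.mem_singleton a) : a ∈ Algebra.adjoin ℂ {a})
  obtain ⟨Pb, eb, Qb, hQb, hPQb, hQPb, heb, hPeb⟩ := exists_additive_resolvent hφ
    (Algebra.subset_adjoin (Set.mem_singleton b) : b ∈ Algebra.adjoin ℂ {b})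
  set x : ℂ⟦X⟧ := PowerSeries.X with hx
  set r := rTransform (distribution φ hφ a)
  set s := rTransform (distribution φ hφ b)
  obtain ⟨T, hDT, hTD, -, -⟩ := exists_inverse (f := 1 - (x * x) • (ea * eb))
    (constantCoeff_one_sub_smul (by simp [hx]) _) ⊤ (fun _ => trivial)
  have hT : T = 1 + (x * x) • (ea * eb * T) := by
    rw [sub_mul, one_mul, smul_mul_assoc, sub_eq_iff_eq_add] at hDT
    exact hDT
  have hΦ := expect_sandwich hφ h hea heb (hea.smul x) (heb.smul x) hT 1 1
  rw [one_smul, ← hPea, ← hPeb, one_mul] at hΦ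
  have hD : 1 - (x * x) • (ea * eb) = Pa + Pb - Pa * Pb := by
    rw [hPea, hPeb, one_sub_smul_mul]
  -- Multiplying P_a + P_b - P_a P_b by the inverses on the two sides makes it linear in a and b,
  -- hence a function of a + b.
  have hQ : Qa * (1 - (x * x) • (ea * eb)) * Qb = Qa + Qb - 1 := by
    rw [hD, mul_sub, mul_add, hQPa, ← mul_assoc, hQPa, one_mul, sub_mul, add_mul, one_mul,
      mul_assoc, hPQb, mul_one, add_comm]
  have hW : Pb * T * Pa * (Qa + Qb - 1) = 1 := by
    rw [← hQ]
    calc Pb * T * Pa * (Qa * (1 - (x * x) • (ea * eb)) * Qb)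
        = Pb * (T * ((Pa * Qa) * (1 - (x * x) • (ea * eb)))) * Qb := by simp only [mul_assoc]
      _ = 1 := by rw [hPQa, one_mul, hTD, mul_one, hPQb]
  have hQ' : Qa + Qb - 1 = (1 + x * (r + s)) • 1 - x • PowerSeries.C (a + b) := by
    rw [hQa, hQb, map_add, smul_one_sub_smul_add]
  refine rTransform_eq_of_subst ?_
  set u : ℂ⟦X⟧ := 1 + x * (r + s) with hu
  have hu0 : PowerSeries.constantCoeff u = 1 := constantCoeff_one_add_X_mul _
  have hui : u * u⁻¹ = 1 := PowerSeries.mul_inv_cancel _ (by simp [hu0])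
  have h2 := expect_resolvent φ hφ (a + b) (c := PowerSeries.X * u⁻¹) (constantCoeff_X_mul _)
    (Q := u • (Pb * T * Pa)) (smul_mul_one_sub_eq_one hui (hQ' ▸ hW))
  have hs : PowerSeries.HasSubst (PowerSeries.X * u⁻¹) :=
    PowerSeries.HasSubst.of_constantCoeff_zero' (constantCoeff_X_mul _)
  rw [cauchySeries, PowerSeries.subst_mul hs, PowerSeries.subst_X hs, ← h2, map_smul,
    hΦ, smul_eq_mul, mul_one, mul_assoc, mul_comm u⁻¹, hui, mul_one]

theorem X_mul_divX_chi (μ : MeanOne) : PowerSeries.X * divX (chi μ) = chi μ :=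
  X_mul_divX (constantCoeff_chi μ)

/-- The inverse of `1 - χ a` for the inverse `χ` of the series `ψ` of `a`. -/
theorem exists_multiplicative_resolvent {φ : A →ₗ[ℂ] ℂ} (hφ : φ 1 = 1) {B : Subalgebra ℂ A}
    {a : A} (ha : a ∈ B) {μ : MeanOne} (hμ : μ.1 = distribution φ hφ a) :
    ∃ Q e : A⟦X⟧, Q * (1 - chi μ • PowerSeries.C a) = 1 ∧
      (1 - chi μ • PowerSeries.C a) * Q = 1 ∧ IsCentred φ B e ∧
      Q = (1 + PowerSeries.X : ℂ⟦X⟧) • 1 + (PowerSeries.X : ℂ⟦X⟧) • e := by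
  obtain ⟨Q, hVQ, hQV, hQ0, hQB⟩ := exists_inverse (f := 1 - chi μ • PowerSeries.C a)
    (constantCoeff_one_sub_smul (constantCoeff_chi μ) _) B (fun n => by
      rw [map_sub]
      exact sub_mem (coeff_one_mem B n) (coeff_series_smul_mem B _ (coeff_C_mem B ha) _))
  have h1 : expect φ Q = 1 + PowerSeries.X := by
    rw [expect_resolvent φ hφ a (constantCoeff_chi μ) hQV, ← hμ, momentSeries_subst_chi]
  obtain ⟨e, he, hQe⟩ := exists_centred_of_resolvent hφ hQB hQ0 (by simp) h1
  exact ⟨Q, e, hQV, hVQ, he, hQe⟩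

theorem sTransform_mul_of_isFree {φ : A →ₗ[ℂ] ℂ} (hφ : φ 1 = 1) {a b : A}
    (h : FreePair φ a b) {μ ν ρ : MeanOne} (hμ : μ.1 = distribution φ hφ a)
    (hν : ν.1 = distribution φ hφ b) (hρ : ρ.1 = distribution φ hφ (a * b)) :
    sTransform ρ = sTransform μ * sTransform ν := by
  obtain ⟨Qa, ea, hQVa, hVQa, hea, hQa⟩ := exists_multiplicative_resolvent hφ
    (Algebra.subset_adjoin (Set.mem_singleton a) : a ∈ Algebra.adjoin ℂ {a}) hμ
  obtain ⟨Qb, eb, hQVb, hVQb, heb, hQb⟩ := exists_multiplicative_resolvent hφ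
    (Algebra.subset_adjoin (Set.mem_singleton b) : b ∈ Algebra.adjoin ℂ {b}) hν
  set x : ℂ⟦X⟧ := PowerSeries.X with hx
  have hx0 : x ≠ 0 := PowerSeries.X_ne_zero
  set c := divX (chi μ) with hc
  set d := divX (chi ν) with hd
  set y : ℂ⟦X⟧ := 1 + x with hy
  have hcx : chi μ = x * c := (X_mul_divX_chi μ).symm
  have hdx : chi ν = x * d := (X_mul_divX_chi ν).symm
  have hyi : y * y⁻¹ = 1 := PowerSeries.mul_inv_cancel _ (by simp [hy, hx])
  obtain ⟨T, hDT, hTD, -, -⟩ := exists_inverse (f := 1 - (x * y⁻¹) • (ea * eb))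
    (constantCoeff_one_sub_smul (by simp [hx]) _) ⊤ (fun _ => trivial)
  have hT : T = 1 + (x * y⁻¹) • (ea * eb * T) := by
    rw [sub_mul, one_mul, smul_mul_assoc, sub_eq_iff_eq_add] at hDT
    exact hDT
  have hΦ := expect_sandwich hφ h hea heb (hea.smul x) (heb.smul x) hT y y
  rw [← hQa, ← hQb] at hΦ
  have cancel : ∀ f g : A⟦X⟧, x • f = x • g → f = g := by
    intro f g hfg
    rw [hx, X_smul_series, X_smul_series] at hfg
    ext n
    simpa [PowerSeries.coeff_succ_X_mul] using congrArg (PowerSeries.coeff (n + 1)) hfg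
  -- The resolvent identity gives χ_a Q_a a = Q_a - 1 = X(1 + e_a); one factor X is cancelled.
  have hca : Qa * (c • PowerSeries.C a) = 1 + ea := by
    refine cancel _ _ ?_
    rw [mul_sub, mul_one, sub_eq_iff_eq_add, ← sub_eq_iff_eq_add', hQa] at hQVa
    rw [← mul_smul_comm, smul_smul, ← hcx, hQa, ← hQVa, smul_one_add_smul_sub_one]
  have hdb : (d • PowerSeries.C b) * Qb = 1 + eb := by
    refine cancel _ _ ?_
    rw [sub_mul, one_mul, sub_eq_iff_eq_add, ← sub_eq_iff_eq_add', hQb] at hVQb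
    rw [← smul_mul_assoc, smul_smul, ← hdx, hQb, ← hVQb, smul_one_add_smul_sub_one]
  -- The candidate for χ of the product, forced by X S = χ (1 + X) and S = (c y)(d y).
  set χ := x * (c * d * y) with hχ
  have hab : χ • PowerSeries.C (a * b) =
      (x * y) • ((c • PowerSeries.C a) * (d • PowerSeries.C b)) := by
    rw [smul_mul_smul_comm, smul_smul, map_mul]
    congr 1
    ring
  have hQ : Qa * (1 - χ • PowerSeries.C (a * b)) * Qb =
      y • (1 - (x * y⁻¹) • (ea * eb)) := by
    have h1 : Qa * (1 - χ • PowerSeries.C (a * b)) * Qb = Qa * Qb -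
        (x * y) • ((Qa * (c • PowerSeries.C a)) * ((d • PowerSeries.C b) * Qb)) := by
      rw [hab, mul_sub, sub_mul, mul_one]
      simp only [mul_smul_comm, smul_mul_assoc, mul_assoc]
    have h2 : y • (1 - (x * y⁻¹) • (ea * eb)) = y • 1 - x • (ea * eb) := by
      rw [smul_sub, smul_smul, show y * (x * y⁻¹) = x * (y * y⁻¹) by ring, hyi, mul_one]
    rw [h1, hca, hdb, h2, hQa, hQb, hy, smul_one_add_smul_mul_sub]
  -- Inserting Q_b (1 - χ_b b) = 1 on the right brings in the factor Q_b that `hQ` needs.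
  have hW : (y⁻¹ • (Qb * T * Qa)) * (1 - χ • PowerSeries.C (a * b)) = 1 := by
    calc (y⁻¹ • (Qb * T * Qa)) * (1 - χ • PowerSeries.C (a * b))
        = y⁻¹ • (Qb * T * (Qa * (1 - χ • PowerSeries.C (a * b)) *
            (Qb * (1 - chi ν • PowerSeries.C b)))) := by
          rw [hQVb, mul_one, smul_mul_assoc, mul_assoc]
      _ = y⁻¹ • (Qb * T * ((Qa * (1 - χ • PowerSeries.C (a * b)) * Qb) *
            (1 - chi ν • PowerSeries.C b))) := by simp only [mul_assoc]
      _ = (y * y⁻¹) • (Qb * (T * (1 - (x * y⁻¹) • (ea * eb))) *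
            (1 - chi ν • PowerSeries.C b)) := by
          rw [hQ, smul_mul_assoc, mul_smul_comm, smul_smul, mul_comm y]
          simp only [mul_assoc]
      _ = 1 := by rw [hTD, mul_one, hQVb, hyi, one_smul]
  have hχ0 : PowerSeries.constantCoeff χ = 0 := constantCoeff_X_mul _
  have h2 := expect_resolvent φ hφ (a * b) hχ0 hW
  rw [map_smul, hΦ, smul_eq_mul, ← hρ, ← mul_assoc, mul_comm y⁻¹, hyi, one_mul] at h2
  have h3 : chi ρ = χ := chi_eq_of_subst hχ0 h2.symm
  refine Subtype.ext (mul_left_cancel₀ hx0 ?_)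
  have hS : ∀ τ : MeanOne, (sTransform τ : ℂ⟦X⟧) = divX (chi τ) * y := fun _ => rfl
  rw [Submonoid.coe_mul, hx, X_mul_sTransform, h3, hS, hS, ← hc, ← hd, hχ]
  ring

end Convolution

/-! ### Transport of the group structures -/

theorem rTransform_freeAdd (μ ν : Distribution) :
    rTransform (freeAdd μ ν) = rTransform μ + rTransform ν := by
  have h := rTransform_add_of_isFree vacuum_one (freePair_freeVar μ ν)
  rwa [distribution_freeVar, distribution_freeVar] at h

theorem sTransform_freeMul (μ ν : MeanOne) :
    sTransform (μ.freeMul ν) = sTransform μ * sTransform ν :=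
  sTransform_mul_of_isFree vacuum_one (freePair_freeVar μ.1 ν.1)
    (distribution_freeVar ![μ.1, ν.1] 0).symm (distribution_freeVar ![μ.1, ν.1] 1).symm rfl

/-- The inverse in `Λ(ℂ)`. -/
def Lam.inv (f : Lam) : Lam := ⟨(f : ℂ⟦X⟧)⁻¹, constantCoeff_inv_eq_one f.2⟩

theorem Lam.inv_mul_self (f : Lam) : Lam.inv f * f = 1 := by
  have hf : PowerSeries.constantCoeff (f : ℂ⟦X⟧) = 1 := f.2
  exact Subtype.ext (PowerSeries.inv_mul_cancel _ (by simp [hf]))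

/-- Free multiplicative convolution makes the distributions with mean `1` an abelian group. -/
@[reducible]
def meanOneCommGroup : CommGroup MeanOne :=
  let S := Equiv.ofBijective sTransform sTransform_bijective
  have hS : ∀ μ ν, S (MeanOne.freeMul μ ν) = S μ * S ν := sTransform_freeMul
  { mul := MeanOne.freeMul
    one := S.symm 1
    inv := fun μ => S.symm (Lam.inv (S μ))
    -- Associativity is inherited from `Lam` through the injective S-transform; no free triple is
    -- needed.
    mul_assoc := fun μ ν ρ => S.injective (by
      change S (MeanOne.freeMul (MeanOne.freeMul μ ν) ρ) =
        S (MeanOne.freeMul μ (MeanOne.freeMul ν ρ))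
      simp only [hS, mul_assoc])
    one_mul := fun μ => S.injective (by
      change S (MeanOne.freeMul (S.symm 1) μ) = S μ
      rw [hS, Equiv.apply_symm_apply, one_mul])
    mul_one := fun μ => S.injective (by
      change S (MeanOne.freeMul μ (S.symm 1)) = S μ
      rw [hS, Equiv.apply_symm_apply, mul_one])
    inv_mul_cancel := fun μ => S.injective (by
      change S (MeanOne.freeMul (S.symm (Lam.inv (S μ))) μ) = S (S.symm 1)
      rw [hS, Equiv.apply_symm_apply, Equiv.apply_symm_apply, Lam.inv_mul_self])
    mul_comm := fun μ ν => S.injective (by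
      change S (MeanOne.freeMul μ ν) = S (MeanOne.freeMul ν μ)
      rw [hS, hS, mul_comm]) }

/-- Free additive convolution makes the distributions an abelian group. -/
@[reducible]
def distributionAddCommGroup : AddCommGroup Distribution :=
  let R := Equiv.ofBijective rTransform rTransform_bijective
  have hR : ∀ μ ν, R (freeAdd μ ν) = R μ + R ν := rTransform_freeAdd
  { add := freeAdd
    zero := R.symm 0
    neg := fun μ => R.symm (-R μ)
    nsmul := @nsmulRec _ ⟨R.symm 0⟩ ⟨freeAdd⟩
    zsmul := @zsmulRec _ ⟨R.symm 0⟩ ⟨freeAdd⟩ ⟨fun μ => R.symm (-R μ)⟩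
      (@nsmulRec _ ⟨R.symm 0⟩ ⟨freeAdd⟩)
    add_assoc := fun μ ν ρ => R.injective (by
      change R (freeAdd (freeAdd μ ν) ρ) = R (freeAdd μ (freeAdd ν ρ))
      simp only [hR, add_assoc])
    zero_add := fun μ => R.injective (by
      change R (freeAdd (R.symm 0) μ) = R μ
      rw [hR, Equiv.apply_symm_apply, zero_add])
    add_zero := fun μ => R.injective (by
      change R (freeAdd μ (R.symm 0)) = R μ
      rw [hR, Equiv.apply_symm_apply, add_zero])
    neg_add_cancel := fun μ => R.injective (by
      change R (freeAdd (R.symm (-R μ)) μ) = R (R.symm 0)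
      rw [hR, Equiv.apply_symm_apply, Equiv.apply_symm_apply, neg_add_cancel])
    add_comm := fun μ ν => R.injective (by
      change R (freeAdd μ ν) = R (freeAdd ν μ)
      rw [hR, hR, add_comm]) }

end

end FreeProb

open FreeProb in
theorem theorem1 :
    ∃ (_ : CommGroup MeanOne) (_ : AddCommGroup Distribution),
      -- the group laws are the free convolutions
      (∀ μ ν : MeanOne, μ * ν = μ.freeMul ν) ∧
      (∀ μ ν : Distribution, μ + ν = freeAdd μ ν) ∧
      -- the three maps composed in the diagram are group isomorphisms
      (Function.Bijective sTransform ∧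
        ∀ μ ν : MeanOne, sTransform (μ * ν) = sTransform μ * sTransform ν) ∧
      (Function.Bijective ghostMap ∧
        ∀ f g : Lam, ghostMap (f * g) = ghostMap f + ghostMap g) ∧
      (Function.Bijective rTransform ∧
        ∀ μ ν : Distribution, rTransform (μ + ν) = rTransform μ + rTransform ν) ∧
      -- the composite is a group isomorphism with inverse `EXP`
      ∃ (LOG : MeanOne → Distribution) (EXP : Distribution → MeanOne),
        (∀ μ : MeanOne, rTransform (LOG μ) = ghostMap (sTransform μ)) ∧
        (∀ μ ν : MeanOne, LOG (μ * ν) = LOG μ + LOG ν) ∧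
        (∀ μ : MeanOne, EXP (LOG μ) = μ) ∧
        (∀ ν : Distribution, LOG (EXP ν) = ν) := by
  let S := Equiv.ofBijective sTransform sTransform_bijective
  let D := Equiv.ofBijective ghostMap ghostMap_bijective
  let R := Equiv.ofBijective rTransform rTransform_bijective
  let L := (S.trans D).trans R.symm
  have hL : ∀ μ, rTransform (L μ) = ghostMap (sTransform μ) := fun μ =>
    R.apply_symm_apply (D (S μ))
  refine ⟨meanOneCommGroup, distributionAddCommGroup, fun _ _ => rfl, fun _ _ => rfl,
    ⟨sTransform_bijective, sTransform_freeMul⟩, ⟨ghostMap_bijective, ghostMap_mul⟩,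
    ⟨rTransform_bijective, rTransform_freeAdd⟩, L, L.symm, hL, fun μ ν => ?_,
    L.symm_apply_apply, L.apply_symm_apply⟩
  -- Since R is injective, additivity of LOG may be checked after applying R, where it follows from
  -- the laws for S, the ghost map and R.
  refine rTransform_bijective.1 ?_
  rw [hL]
  refine Eq.trans ?_ (rTransform_freeAdd _ _).symm
  rw [hL, hL, ← ghostMap_mul]
  exact congrArg ghostMap (sTransform_freeMul μ ν)
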